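/- A \emph{polytope} $P$ is the convex hull of a finite (possibly empty) set of points in a finite dimensional real vector space $E_P$. An \emph{affine map} $P\to Q$ between polytopes is a map of sets that is the restriction of an affine map $E_P\to E_Q$ between the ambient vector spaces. Let $\mathrm{Pol}$ be the category of polytopes and affine maps. For polytopes $P,Q$ put $$P\otimes Q=\mathrm{conv}\{(x\otimes y,x,y)\mid x\in P,\ y\in Q\}\subset (E_P\otimes E_Q)\oplus E_P\oplus E_Q,$$ write $x\boxtimes y=(x\otimes y,x,y)\in P\otimes Q$ for $x\in P$, $y\in Q$, let $\{*\}$ be the one-point polytope, and let $\mathrm{Hom}(P,Q)$ be the set of affine maps $P\to Q$, viewed as a subset of the finite dimensional real vector space of affine maps $P\to E_Q$ (with pointwise operations). Then every $\mathrm{Hom}(P,Q)$ is a polytope (the hom-polytope), and $\mathrm{Pol}$ is a symmetric closed monoidal category with tensor product $P\otimes Q$, unit object $\{*\}$ and internal hom $\mathrm{Hom}(P,Q)$. The structure is given by \begin{itemize} \item $(f\otimes g)(x\boxtimes y)=f(x)\boxtimes g(y)$ for affine maps $f,g$; \item associator $(P\otimes Q)\otimes R\to P\otimes(Q\otimes R)$,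 $(x\boxtimes y)\boxtimes z\mapsto x\boxtimes(y\boxtimes z)$; \item unitors $\{*\}\otimes P\to P$, $*\boxtimes x\mapsto x$, and $P\otimes\{*\}\to P$, $x\boxtimes *\mapsto x$; \item symmetry $P\otimes Q\to Q\otimes P$, $x\boxtimes y\mapsto y\boxtimes x$; \item for each $P$, the functor $\mathrm{Hom}(P,-)$, with $\mathrm{Hom}(P,g)(f)=g\circ f$, is right adjoint to $P\otimes-$, with counit $P\otimes\mathrm{Hom}(P,Q)\to Q$, $x\boxtimes f\mapsto f(x)$. \end{itemize} Moreover, $\mathrm{Pol}$ is enriched over this monoidal category: there is a $\mathrm{Pol}$-enriched category whose objects are the polytopes, whose hom-objects are the hom-polytopes $\mathrm{Hom}(P,Q)$, whose composition $\mathrm{Hom}(P,Q)\otimes\mathrm{Hom}(Q,R)\to\mathrm{Hom}(P,R)$ is $f\boxtimes g\mapsto g\circ f$, whose identities $\{*\}\to\mathrm{Hom}(P,P)$ are $*\mapsto\mathrm{id}_P$, and whose underlying ordinary category is $\mathrm{Pol}$, an affine map $f:P\to Q$ corresponding to the morphism $\{*\}\to\mathrm{Hom}(P,Q)$, $*\mapsto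 f$. -/

import Mathlib

open CategoryTheory MonoidalCategory
open scoped TensorProduct

universe u

/-- A (convex) polytope in a real vector space: the convex hull of finitely many points. -/
def IsPolytope {E : Type*} [AddCommGroup E] [Module ℝ E] (S : Set E) : Prop :=
  ∃ s : Set E, s.Finite ∧ convexHull ℝ s = S

/-- An object of the category of polytopes: a finite dimensional real vector space together with
a polytope in it. -/
structure Pol : Type (u + 1) where
  /-- the ambient vector space -/
  E : Type u
  [addCommGroup : AddCommGroup E]
  [module : Module ℝ E]
  [finiteDimensional : FiniteDimensional ℝ E]
  /-- the underlying set of the polytope -/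
  carrier : Set E
  isPolytope : IsPolytope carrier

namespace Pol

attribute [instance] Pol.addCommGroup Pol.module Pol.finiteDimensional

instance : CoeSort Pol.{u} (Type u) := ⟨fun P => P.carrier⟩

/-- An affine map between polytopes: a map which is the restriction of an affine map between the
ambient vector spaces. -/
@[ext]
structure Hom (P Q : Pol.{u}) : Type u where
  toFun : P → Q
  affine : ∃ g : P.E →ᵃ[ℝ] Q.E, ∀ x : P, g x.1 = (toFun x).1

/-- The category of polytopes and affine maps. -/
instance : Category.{u} Pol.{u} where
  Hom := Hom
  id P := ⟨fun x => x, AffineMap.id ℝ P.E, fun _ => rfl⟩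
  comp f g := ⟨fun x => g.toFun (f.toFun x), by
    obtain ⟨a, ha⟩ := f.affine
    obtain ⟨b, hb⟩ := g.affine
    exact ⟨b.comp a, fun x => by rw [AffineMap.comp_apply, ha, hb]⟩⟩

/-- The one-point polytope `{*}`. -/
def point : Pol.{u} where
  E := PUnit.{u + 1}
  carrier := Set.univ
  isPolytope := ⟨Set.univ, Set.finite_univ, convexHull_univ⟩

/-- The unique point of the one-point polytope. -/
def star : point.{u} := ⟨PUnit.unit, trivial⟩

/-- The generating set `{(x ⊗ y, x, y) | x ∈ P, y ∈ Q}` of the tensor product of polytopes. -/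
def tensorGenerators (P Q : Pol.{u}) : Set ((P.E ⊗[ℝ] Q.E) × P.E × Q.E) :=
  {z | ∃ x ∈ P.carrier, ∃ y ∈ Q.carrier, z = (x ⊗ₜ[ℝ] y, x, y)}

theorem isPolytope_convexHull_tensorGenerators (P Q : Pol.{u}) :
    IsPolytope (convexHull ℝ (tensorGenerators P Q)) := by
  obtain ⟨s, hs, hsP⟩ := P.isPolytope
  obtain ⟨t, ht, htQ⟩ := Q.isPolytope
  let φ : P.E × Q.E → (P.E ⊗[ℝ] Q.E) × P.E × Q.E := fun p => (p.1 ⊗ₜ[ℝ] p.2, p.1, p.2)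
  have hK : Convex ℝ (convexHull ℝ (φ '' (s ×ˢ t))) := convex_convexHull ℝ _
  have h1 : ∀ x ∈ P.carrier, ∀ y ∈ t, φ (x, y) ∈ convexHull ℝ (φ '' (s ×ˢ t)) := by
    intro x hx y hy
    rw [← hsP] at hx
    refine convexHull_min (t := {x | φ (x, y) ∈ convexHull ℝ (φ '' (s ×ˢ t))}) ?_ ?_ hx
    · exact fun x hx => subset_convexHull ℝ _ ⟨(x, y), ⟨hx, hy⟩, rfl⟩
    · intro x hx x' hx' a b ha hb hab
      have key : φ (a • x + b • x', y) = a • φ (x, y) + b • φ (x', y) := by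
        simp [φ, TensorProduct.add_tmul, TensorProduct.smul_tmul', ← add_smul, hab]
      have := hK hx hx' ha hb hab
      rwa [← key] at this
  have h2 : ∀ x ∈ P.carrier, ∀ y ∈ Q.carrier, φ (x, y) ∈ convexHull ℝ (φ '' (s ×ˢ t)) := by
    intro x hx y hy
    rw [← htQ] at hy
    refine convexHull_min (t := {y | φ (x, y) ∈ convexHull ℝ (φ '' (s ×ˢ t))}) ?_ ?_ hy
    · exact fun y hy => h1 x hx y hy
    · intro y hy y' hy' a b ha hb hab
      have key : φ (x, a • y + b • y') = a • φ (x, y) + b • φ (x, y') := by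
        simp [φ, TensorProduct.tmul_add, TensorProduct.tmul_smul, ← add_smul, hab]
      have := hK hy hy' ha hb hab
      rwa [← key] at this
  refine ⟨φ '' (s ×ˢ t), (hs.prod ht).image φ, Set.Subset.antisymm ?_ ?_⟩
  · refine convexHull_mono ?_
    rintro _ ⟨⟨x, y⟩, ⟨hx, hy⟩, rfl⟩
    exact ⟨x, hsP ▸ subset_convexHull ℝ s hx, y, htQ ▸ subset_convexHull ℝ t hy, rfl⟩
  · refine convexHull_min ?_ hK
    rintro _ ⟨x, hx, y, hy, rfl⟩
    exact h2 x hx y hy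

/-- The tensor product `P ⊗ Q = conv {(x ⊗ y, x, y) | x ∈ P, y ∈ Q}` of polytopes. -/
def tensor (P Q : Pol.{u}) : Pol.{u} where
  E := (P.E ⊗[ℝ] Q.E) × P.E × Q.E
  carrier := convexHull ℝ (tensorGenerators P Q)
  isPolytope := isPolytope_convexHull_tensorGenerators P Q

/-- The universal bi-affine map `P × Q → P ⊗ Q`, `(x, y) ↦ (x ⊗ y, x, y)`. -/
def tmul {P Q : Pol.{u}} (x : P) (y : Q) : tensor P Q :=
  ⟨(x.1 ⊗ₜ[ℝ] y.1, x.1, y.1), by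
    exact subset_convexHull ℝ (tensorGenerators P Q) ⟨x.1, x.2, y.1, y.2, rfl⟩⟩

/-- The vector space (under pointwise operations) of all affine maps from the polytope `P` to the
vector space `F`, i.e. of the restrictions to `P` of affine maps from the ambient space to `F`. -/
def affineMaps (P : Pol.{u}) (F : Type u) [AddCommGroup F] [Module ℝ F] :
    Submodule ℝ (P → F) where
  carrier := {φ | ∃ g : P.E →ᵃ[ℝ] F, ∀ x : P, g x.1 = φ x}
  add_mem' := by
    rintro φ ψ ⟨g, hg⟩ ⟨h, hh⟩
    exact ⟨g + h, fun x => by simp [hg, hh]⟩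
  zero_mem' := ⟨0, fun x => by simp⟩
  smul_mem' := by
    rintro c φ ⟨g, hg⟩
    exact ⟨c • g, fun x => by simp [hg]⟩

instance (P : Pol.{u}) (F : Type u) [AddCommGroup F] [Module ℝ F] [FiniteDimensional ℝ F] :
    FiniteDimensional ℝ (affineMaps P F) := by
  let r : (P.E →ᵃ[ℝ] F) →ₗ[ℝ] affineMaps P F :=
    { toFun := fun g => ⟨fun x => g x.1, g, fun _ => rfl⟩
      map_add' := fun _ _ => rfl
      map_smul' := fun _ _ => rfl }
  refine Module.Finite.of_surjective r ?_
  rintro ⟨φ, g, hg⟩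
  exact ⟨g, Subtype.ext (funext hg)⟩

/-- The set of affine maps `P → Q`, as a subset of the vector space of affine maps from `P` to the
ambient space of `Q`. -/
def homSet (P Q : Pol.{u}) : Set (affineMaps P Q.E) :=
  {φ | ∀ x : P, φ.1 x ∈ Q.carrier}

/-- The hom-polytope `Hom(P, Q)`, given that the set of affine maps `P → Q` is a polytope. -/
def homPolytope (P Q : Pol.{u}) (h : IsPolytope (homSet P Q)) : Pol.{u} where
  E := affineMaps P Q.E
  carrier := homSet P Q
  isPolytope := h

/-- An affine map `P → Q`, regarded as a point of the hom-polytope `Hom(P, Q)`. -/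
def toPoint {P Q : Pol.{u}} (h : IsPolytope (homSet P Q)) (f : P ⟶ Q) : homPolytope P Q h :=
  ⟨⟨fun x => (f.toFun x).1, f.affine⟩, fun x => (f.toFun x).2⟩

theorem toPoint_bijective {P Q : Pol.{u}} (h : IsPolytope (homSet P Q)) :
    Function.Bijective (toPoint h : (P ⟶ Q) → homPolytope P Q h) := by
  constructor
  · intro f g hfg
    refine Hom.ext (funext fun x => Subtype.ext ?_)
    exact congrFun (congrArg (fun φ => φ.1.1) hfg) x
  · rintro ⟨⟨φ, hφ⟩, hQ⟩
    exact ⟨⟨fun x => ⟨φ x, hQ x⟩, hφ⟩, rfl⟩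

/-- The point of `Q` corresponding to a point `x` of `P` when `P` and `Q` are the same polytope. -/
def cast {P Q : Pol.{u}} (h : P = Q) (x : P) : Q := (eqToHom h).toFun x

end Pol

/-!
Evaluation at the vertices of `P` embeds `Hom(P, Q)` affinely into a product of copies of `Q`, with
image the intersection of this product with an affine subspace. An affine section of a polytope is
again a polytope: it is the image of an affine section of a simplex, and an extreme point of the
latter is determined by its support, so there are finitely many extreme points and the
Krein–Milman theorem applies.

The tensor product `P ⊗ Q` represents the maps out of `P × Q` which are affine in each variable,
because such a map extends to a biaffine map of the ambient spaces, hence to an affine map on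
`(E_P ⊗ E_Q) ⊕ E_P ⊕ E_Q`. Such maps are at the same time the affine maps `Q → Hom(P, R)`, which
gives the closed structure. All coherence conditions can be checked on the points `x ⊠ y`, and the
enrichment is that of a closed monoidal category over itself.
-/

section Polytopes

open scoped Topology

variable {ι E F : Type*} [AddCommGroup E] [Module ℝ E] [AddCommGroup F] [Module ℝ F]

theorem exists_pos_mul_le_of_support_subset [Finite ι] {v w : ι → ℝ} (hv : ∀ i, 0 ≤ v i)
    (hvw : Function.support w ⊆ Function.support v) : ∃ ε : ℝ, 0 < ε ∧ ∀ i, ε * w i ≤ v i := by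
  have eventually_le : ∀ᶠ ε in 𝓝[>] (0 : ℝ), ∀ i, ε * w i ≤ v i := by
    refine Filter.eventually_all.2 fun i => ?_
    by_cases hi : v i = 0
    · simp [hi, Function.notMem_support.1 fun h => hvw h hi]
    · have tendsto : Filter.Tendsto (fun ε => ε * w i) (𝓝[>] 0) (𝓝 (0 * w i)) :=
        ((continuous_mul_const (w i)).tendsto 0).mono_left nhdsWithin_le_nhds
      rw [zero_mul] at tendsto
      exact (tendsto.eventually_lt_const ((hv i).lt_of_ne' hi)).mono fun _ => le_of_lt
  exact (eventually_mem_nhdsWithin.and eventually_le).exists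

/-- Otherwise the segment from `w` to `v` could be prolonged beyond `v` inside the section. -/
theorem eq_of_mem_extremePoints_stdSimplex_inter [Fintype ι] {L : AffineSubspace ℝ (ι → ℝ)}
    {v w : ι → ℝ} (hv : v ∈ (stdSimplex ℝ ι ∩ L).extremePoints ℝ) (hw : w ∈ stdSimplex ℝ ι ∩ L)
    (hvw : Function.support w ⊆ Function.support v) : w = v := by
  obtain ⟨⟨⟨hv0, hv1⟩, hvL⟩, hextreme⟩ := hv
  obtain ⟨ε, hε, hεv⟩ := exists_pos_mul_le_of_support_subset hv0 hvw
  let z := AffineMap.lineMap w v (1 + ε)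
  have hz (i : ι) : z i = (1 + ε) * v i - ε * w i := by
    simp only [z, AffineMap.lineMap_apply, vsub_eq_sub, vadd_eq_add, Pi.add_apply, Pi.smul_apply,
      Pi.sub_apply, smul_eq_mul]
    ring
  have hz_mem : z ∈ stdSimplex ℝ ι := by
    refine ⟨fun i => ?_, ?_⟩
    · rw [hz]
      nlinarith [hv0 i, hεv i]
    · simp only [hz, Finset.sum_sub_distrib, ← Finset.mul_sum, hv1, hw.1.2]
      ring
  refine hextreme hw ⟨hz_mem, AffineMap.lineMap_mem _ hw.2 hvL⟩
    ⟨ε / (1 + ε), 1 / (1 + ε), by positivity, by positivity, by field_simp; ring, ?_⟩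
  ext i
  simp only [Pi.add_apply, Pi.smul_apply, smul_eq_mul, hz]
  field_simp
  ring

theorem finite_extremePoints_stdSimplex_inter [Fintype ι] (L : AffineSubspace ℝ (ι → ℝ)) :
    ((stdSimplex ℝ ι ∩ L).extremePoints ℝ).Finite :=
  Set.Finite.of_injOn (f := Function.support) (Set.mapsTo_univ _ _)
    (fun _ hv _ hw h => (eq_of_mem_extremePoints_stdSimplex_inter hw hv.1 h.le))
    Set.finite_univ

theorem isPolytope_stdSimplex_inter [Fintype ι] (L : AffineSubspace ℝ (ι → ℝ)) :
    IsPolytope (stdSimplex ℝ ι ∩ L) := by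
  have hfin := finite_extremePoints_stdSimplex_inter L
  refine ⟨_, hfin, ?_⟩
  rw [← (hfin.isClosed_convexHull ℝ).closure_eq]
  exact closure_convexHull_extremePoints
    ((isCompact_stdSimplex ℝ ι).inter_right L.closed_of_finiteDimensional)
    ((convex_stdSimplex ℝ ι).inter L.convex)

namespace IsPolytope

theorem convex {S : Set E} : IsPolytope S → Convex ℝ S := by
  rintro ⟨s, -, rfl⟩
  exact convex_convexHull ℝ s

theorem image {S : Set E} (hS : IsPolytope S) (f : E →ᵃ[ℝ] F) : IsPolytope (f '' S) := by
  obtain ⟨s, hs, rfl⟩ := hS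
  exact ⟨f '' s, hs.image f, (f.image_convexHull s).symm⟩

theorem of_image {T : Set E} {f : E →ᵃ[ℝ] F} (hf : Function.Injective f)
    (hT : IsPolytope (f '' T)) : IsPolytope T := by
  obtain ⟨s, hs, hsT⟩ := hT
  obtain ⟨t, -, rfl⟩ := Set.subset_image_iff.1 (hsT ▸ subset_convexHull ℝ s)
  refine ⟨t, hs.of_finite_image hf.injOn, hf.image_injective ?_⟩
  rw [f.image_convexHull, hsT]

theorem pi [Finite ι] {E : ι → Type*} [∀ i, AddCommGroup (E i)] [∀ i, Module ℝ (E i)]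
    {S : ∀ i, Set (E i)} (hS : ∀ i, IsPolytope (S i)) : IsPolytope (Set.univ.pi S) := by
  choose s hs hsS using hS
  exact ⟨Set.univ.pi s, Set.Finite.pi hs, by rw [convexHull_pi, funext hsS]⟩

/-- A polytope is the image of a standard simplex under a linear map, so that only affine sections
of the standard simplex have to be considered. -/
theorem inter_affineSubspace {S : Set E} (hS : IsPolytope S) (L : AffineSubspace ℝ E) :
    IsPolytope (S ∩ L) := by
  obtain ⟨s, hs, rfl⟩ := hS
  let := hs.fintype
  rw [hs.convexHull_eq_image, ← Set.image_inter_preimage]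
  let φ : (s → ℝ) →ₗ[ℝ] E := ∑ x : s, (LinearMap.proj x).smulRight x.1
  exact (isPolytope_stdSimplex_inter (L.comap φ.toAffineMap)).image φ.toAffineMap

theorem preimage {S : Set F} (hS : IsPolytope S) {f : E →ᵃ[ℝ] F} (hf : Function.Injective f) :
    IsPolytope (f ⁻¹' S) := by
  refine of_image hf ?_
  rw [Set.image_preimage_eq_inter_range, ← Set.image_univ]
  exact hS.inter_affineSubspace (AffineSubspace.map f ⊤)

end IsPolytope

end Polytopes

theorem exists_affineMap_tmul_eq {V W F : Type*} [AddCommGroup V] [Module ℝ V] [AddCommGroup W]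
    [Module ℝ W] [AddCommGroup F] [Module ℝ F] (f : V →ᵃ[ℝ] (W →ᵃ[ℝ] F)) :
    ∃ g : (V ⊗[ℝ] W) × V × W →ᵃ[ℝ] F, ∀ x y, g (x ⊗ₜ[ℝ] y, x, y) = f x y := by
  let evalZero := LinearMap.fst ℝ F (W →ₗ[ℝ] F) ∘ₗ (AffineMap.toConstProdLinearMap ℝ).toLinearMap
  let linear := LinearMap.snd ℝ F (W →ₗ[ℝ] F) ∘ₗ (AffineMap.toConstProdLinearMap ℝ).toLinearMap
  let T : (V ⊗[ℝ] W) × V × W →ₗ[ℝ] F :=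
    (TensorProduct.lift (linear ∘ₗ f.linear)).coprod
      ((evalZero ∘ₗ f.linear).coprod (f 0).linear)
  refine ⟨T.toAffineMap + AffineMap.const ℝ _ (f 0 0), fun x y => ?_⟩
  have decomp_apply (h : W →ᵃ[ℝ] F) : h y = h.linear y + h 0 := congrFun h.decomp y
  calc T (x ⊗ₜ y, x, y) + f 0 0
      = (f.linear x).linear y + (f.linear x 0 + (f 0).linear y) + f 0 0 := by
        simp only [T, LinearMap.coprod_apply, TensorProduct.lift.tmul]
        rfl
    _ = ((f.linear x).linear y + f.linear x 0) + ((f 0).linear y + f 0 0) := by abel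
    _ = f.linear x y + f 0 y := by rw [← decomp_apply, ← decomp_apply]
    _ = f x y := (congrArg (· y) (congrFun f.decomp x)).symm

namespace Pol

variable {P Q R S : Pol.{u}} {F : Type u} [AddCommGroup F] [Module ℝ F]

theorem exists_finite_convexHull_eq_carrier (P : Pol.{u}) :
    ∃ s : Set P, s.Finite ∧ convexHull ℝ (Subtype.val '' s) = P.carrier := by
  obtain ⟨s, hs, hsP⟩ := P.isPolytope
  refine ⟨Subtype.val ⁻¹' s, hs.preimage Subtype.val_injective.injOn, ?_⟩
  rw [Subtype.image_preimage_coe, Set.inter_eq_right.2 (hsP ▸ subset_convexHull ℝ s), hsP]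

/-- Evaluation of affine maps at the points of `s`. For `s` containing the vertices of `P` it is
injective and realizes `Hom(P, Q)` inside a product of copies of `Q`. -/
def evalOn (s : Set P) : affineMaps P F →ₗ[ℝ] (s → F) :=
  LinearMap.funLeft ℝ F Subtype.val ∘ₗ (affineMaps P F).subtype

theorem evalOn_injective {s : Set P} (hs : convexHull ℝ (Subtype.val '' s) = P.carrier) :
    Function.Injective (evalOn (F := F) s) := by
  intro φ ψ hφψ
  obtain ⟨g, hg⟩ := φ.2
  obtain ⟨h, hh⟩ := ψ.2
  have eqOn_s : Set.EqOn g h (Subtype.val '' s) := by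
    rintro _ ⟨x, hx, rfl⟩
    rw [hg, hh]
    exact congrFun hφψ ⟨x, hx⟩
  refine Subtype.ext (funext fun x => ?_)
  rw [← hg, ← hh]
  exact AffineMap.eqOn_affineSpan eqOn_s (convexHull_subset_affineSpan _ (hs.ge x.2))

theorem homSet_eq_evalOn_preimage {s : Set P}
    (hs : convexHull ℝ (Subtype.val '' s) = P.carrier) :
    homSet P Q = evalOn s ⁻¹' Set.univ.pi fun _ => Q.carrier := by
  ext φ
  refine ⟨fun h x _ => h x, fun h x => ?_⟩
  obtain ⟨g, hg⟩ := φ.2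
  have maps_s : Subtype.val '' s ⊆ g ⁻¹' Q.carrier := by
    rintro _ ⟨v, hv, rfl⟩
    rw [Set.mem_preimage, hg]
    exact h ⟨v, hv⟩ trivial
  rw [← hg]
  exact convexHull_min maps_s (Q.isPolytope.convex.affine_preimage g) (hs.ge x.2)

theorem isPolytope_homSet (P Q : Pol.{u}) : IsPolytope (homSet P Q) := by
  obtain ⟨s, hs_finite, hs⟩ := P.exists_finite_convexHull_eq_carrier
  have := hs_finite.to_subtype
  let f : affineMaps P Q.E →ᵃ[ℝ] (s → Q.E) := (evalOn s).toAffineMap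
  rw [homSet_eq_evalOn_preimage hs]
  exact (IsPolytope.pi fun _ => Q.isPolytope).preimage (f := f) (evalOn_injective hs)

/-- The internal hom `Hom(P, Q)` of polytopes. -/
abbrev internalHom (P Q : Pol.{u}) : Pol.{u} := homPolytope P Q (isPolytope_homSet P Q)

/-- The point of `Hom(P, Q)` corresponding to a morphism. -/
abbrev pointOf (f : P ⟶ Q) : internalHom P Q := toPoint (isPolytope_homSet P Q) f

/-- The morphism corresponding to a point of `Hom(P, Q)`. -/
def ofPoint (φ : internalHom P Q) : P ⟶ Q := Hom.mk (fun x => ⟨φ.1.1 x, φ.2 x⟩) φ.1.2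

@[simp]
theorem ofPoint_pointOf (f : P ⟶ Q) : ofPoint (pointOf f) = f := rfl

@[simp]
theorem id_toFun (x : P) : Hom.toFun (𝟙 P) x = x := rfl

@[simp]
theorem comp_toFun (f : P ⟶ Q) (g : Q ⟶ R) (x : P) : (f ≫ g).toFun x = g.toFun (f.toFun x) := rfl

theorem hom_ext {f g : P ⟶ Q} (h : ∀ x, f.toFun x = g.toFun x) : f = g := Hom.ext (funext h)

/-- A map of polytopes is affine if it underlies a morphism. -/
def IsAffine (φ : P → Q) : Prop := (fun x => (φ x).1) ∈ affineMaps P Q.E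

namespace IsAffine

/-- The morphism underlain by an affine map. -/
def hom {φ : P → Q} (hφ : IsAffine φ) : P ⟶ Q := Hom.mk φ hφ

theorem of_hom (f : P ⟶ Q) : IsAffine f.toFun := f.affine

theorem comp {φ : P → Q} {ψ : Q → R} (hψ : IsAffine ψ) (hφ : IsAffine φ) :
    IsAffine fun x => ψ (φ x) :=
  of_hom (hφ.hom ≫ hψ.hom)

theorem const (y : Q) : IsAffine fun _ : P => y := ⟨AffineMap.const ℝ P.E y.1, fun _ => rfl⟩

end IsAffine

theorem mem_affineMaps_affineMaps {φ : P → affineMaps Q F}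
    (h : ∀ y, (fun x => (φ x).1 y) ∈ affineMaps P F) : φ ∈ affineMaps P (affineMaps Q F) := by
  choose g hg using h
  obtain ⟨ρ, hρ⟩ := (affineMaps Q F).subtype.exists_leftInverse_of_injective
    (affineMaps Q F).ker_subtype
  refine ⟨ρ.toAffineMap.comp (AffineMap.pi g), fun x => ?_⟩
  have : AffineMap.pi g x = (affineMaps Q F).subtype (φ x) := funext fun y => hg y x
  rw [AffineMap.comp_apply, this]
  exact LinearMap.congr_fun hρ (φ x)

theorem isAffine_pointOf {f : P → (Q ⟶ R)} (h : ∀ y, IsAffine fun x => (f x).toFun y) :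
    IsAffine fun x => pointOf (f x) :=
  mem_affineMaps_affineMaps h

/-- A map `P × Q → R`, in curried form, which is affine in each variable. -/
structure IsBiaffine (φ : P → Q → R) : Prop where
  left : ∀ y, IsAffine fun x => φ x y
  right : ∀ x, IsAffine (φ x)

theorem isBiaffine_ofPoint_toFun :
    IsBiaffine fun (x : P) (φ : internalHom P Q) => (ofPoint φ).toFun x where
  left φ := .of_hom (ofPoint φ)
  right x := ⟨(LinearMap.proj x ∘ₗ (affineMaps P Q.E).subtype).toAffineMap, fun _ => rfl⟩

theorem isBiaffine_tmul : IsBiaffine (tmul : P → Q → tensor P Q) where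
  left y := ⟨((TensorProduct.mk ℝ P.E Q.E).flip y.1).toAffineMap.prod
    ((AffineMap.id ℝ P.E).prod (AffineMap.const ℝ P.E y.1)), fun _ => rfl⟩
  right x := ⟨(TensorProduct.mk ℝ P.E Q.E x.1).toAffineMap.prod
    ((AffineMap.const ℝ Q.E x.1).prod (AffineMap.id ℝ Q.E)), fun _ => rfl⟩

/-- The map `y ↦ x ⊠ y`. -/
def tmulLeft (x : P) : Q ⟶ tensor P Q := (isBiaffine_tmul.right x).hom

/-- The map `x ↦ x ⊠ y`. -/
def tmulRight (y : Q) : P ⟶ tensor P Q := (isBiaffine_tmul.left y).hom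

@[simp]
theorem tmulLeft_toFun (x : P) (y : Q) : (tmulLeft x).toFun y = tmul x y := rfl

@[simp]
theorem tmulRight_toFun (x : P) (y : Q) : (tmulRight y).toFun x = tmul x y := rfl

/-- Restriction of affine maps from the ambient space of `P` to `P`. -/
def restrict (P : Pol.{u}) (F : Type u) [AddCommGroup F] [Module ℝ F] :
    (P.E →ᵃ[ℝ] F) →ₗ[ℝ] affineMaps P F where
  toFun g := ⟨fun x => g x.1, g, fun _ => rfl⟩
  map_add' _ _ := rfl
  map_smul' _ _ := rfl

theorem restrict_surjective : Function.Surjective (restrict P F) := fun φ => by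
  obtain ⟨g, hg⟩ := φ.2
  exact ⟨g, Subtype.ext (funext hg)⟩

namespace IsBiaffine

variable {φ : P → Q → R}

theorem comp {P' Q' : Pol.{u}} (h : IsBiaffine φ) (f : P' ⟶ P) (g : Q' ⟶ Q) :
    IsBiaffine fun x y => φ (f.toFun x) (g.toFun y) where
  left y := (h.left (g.toFun y)).comp (.of_hom f)
  right x := (h.right (f.toFun x)).comp (.of_hom g)

theorem exists_biaffineMap_eq (h : IsBiaffine φ) :
    ∃ f : P.E →ᵃ[ℝ] (Q.E →ᵃ[ℝ] R.E), ∀ (x : P) (y : Q), f x.1 y.1 = (φ x y).1 := by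
  obtain ⟨g, hg⟩ :=
    mem_affineMaps_affineMaps (φ := fun x => ⟨fun y => (φ x y).1, h.right x⟩) h.left
  obtain ⟨σ, hσ⟩ := (restrict Q R.E).exists_rightInverse_of_surjective
    (LinearMap.range_eq_top.2 restrict_surjective)
  refine ⟨σ.toAffineMap.comp g, fun x y => ?_⟩
  have : restrict Q R.E (σ (g x.1)) = g x.1 := LinearMap.congr_fun hσ (g x.1)
  exact congrFun (congrArg Subtype.val (this.trans (hg x))) y

theorem exists_hom_tmul_eq (h : IsBiaffine φ) :
    ∃ f : tensor P Q ⟶ R, ∀ x y, f.toFun (tmul x y) = φ x y := by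
  obtain ⟨f, hf⟩ := h.exists_biaffineMap_eq
  obtain ⟨g, hg⟩ := exists_affineMap_tmul_eq f
  have hgφ (x : P) (y : Q) : g (tmul x y).1 = (φ x y).1 := (hg x.1 y.1).trans (hf x y)
  have maps_generators : tensorGenerators P Q ⊆ g ⁻¹' R.carrier := by
    rintro _ ⟨x, hx, y, hy, rfl⟩
    change g (tmul ⟨x, hx⟩ ⟨y, hy⟩ : tensor P Q).1 ∈ R.carrier
    rw [hgφ]
    exact (φ ⟨x, hx⟩ ⟨y, hy⟩).2
  have maps_tensor := convexHull_min maps_generators (R.isPolytope.convex.affine_preimage g)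
  exact ⟨Hom.mk (fun w => ⟨g w.1, maps_tensor w.2⟩) ⟨g, fun _ => rfl⟩,
    fun x y => Subtype.ext (hgφ x y)⟩

/-- The morphism `P ⊗ Q ⟶ R` induced by a biaffine map. -/
noncomputable def lift (h : IsBiaffine φ) : tensor P Q ⟶ R := h.exists_hom_tmul_eq.choose

@[simp]
theorem lift_tmul (h : IsBiaffine φ) (x : P) (y : Q) : h.lift.toFun (tmul x y) = φ x y :=
  h.exists_hom_tmul_eq.choose_spec x y

end IsBiaffine

theorem tensor_hom_ext {f g : tensor P Q ⟶ R}
    (h : ∀ x y, f.toFun (tmul x y) = g.toFun (tmul x y)) : f = g := by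
  obtain ⟨a, ha⟩ := f.affine
  obtain ⟨b, hb⟩ := g.affine
  have eqOn_generators : Set.EqOn a b (tensorGenerators P Q) := by
    rintro _ ⟨x, hx, y, hy, rfl⟩
    let w := tmul (⟨x, hx⟩ : P) (⟨y, hy⟩ : Q)
    exact (ha w).trans ((congrArg Subtype.val (h _ _)).trans (hb w).symm)
  refine hom_ext fun w => Subtype.ext ?_
  rw [← ha, ← hb]
  exact AffineMap.eqOn_affineSpan eqOn_generators (convexHull_subset_affineSpan _ w.2)

theorem tensor_hom_ext_left {f g : tensor (tensor P Q) R ⟶ S}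
    (h : ∀ x y z, f.toFun (tmul (tmul x y) z) = g.toFun (tmul (tmul x y) z)) : f = g :=
  tensor_hom_ext fun w z => by
    have : tmulRight z ≫ f = tmulRight z ≫ g := tensor_hom_ext fun x y => h x y z
    exact congrArg (fun k => Hom.toFun k w) this

theorem tensor_hom_ext_right {f g : tensor P (tensor Q R) ⟶ S}
    (h : ∀ x y z, f.toFun (tmul x (tmul y z)) = g.toFun (tmul x (tmul y z))) : f = g :=
  tensor_hom_ext fun x w => by
    have : tmulLeft x ≫ f = tmulLeft x ≫ g := tensor_hom_ext fun y z => h x y z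
    exact congrArg (fun k => Hom.toFun k w) this

section Monoidal

/-- The morphism `P ⊗ Q ⟶ R` corresponding to a family of morphisms `P ⟶ R` which depends affinely
on a point of `Q`. -/
noncomputable def uncurry (f : Q ⟶ internalHom P R) : tensor P Q ⟶ R :=
  (isBiaffine_ofPoint_toFun.comp (𝟙 P) f).lift

@[simp]
theorem uncurry_tmul (f : Q ⟶ internalHom P R) (x : P) (y : Q) :
    (uncurry f).toFun (tmul x y) = (ofPoint (f.toFun y)).toFun x :=
  IsBiaffine.lift_tmul _ x y

/-- The inverse construction to `uncurry`. -/
def curry (f : tensor P Q ⟶ R) : Q ⟶ internalHom P R :=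
  IsAffine.hom (φ := fun y => pointOf (tmulRight y ≫ f))
    (isAffine_pointOf fun x => .of_hom (tmulLeft x ≫ f))

@[simp]
theorem curry_toFun (f : tensor P Q ⟶ R) (y : Q) :
    (curry f).toFun y = pointOf (tmulRight y ≫ f) := rfl

theorem uncurry_curry (f : tensor P Q ⟶ R) : uncurry (curry f) = f :=
  tensor_hom_ext fun x y => by simp

theorem curry_uncurry (f : Q ⟶ internalHom P R) : curry (uncurry f) = f :=
  hom_ext fun y => congrArg pointOf <|
    hom_ext (g := ofPoint (f.toFun y)) fun x => uncurry_tmul f x y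

/-- The symmetry of the tensor product. -/
noncomputable def swapHom (P Q : Pol.{u}) : tensor P Q ⟶ tensor Q P :=
  IsBiaffine.lift (φ := fun x y => tmul y x) ⟨isBiaffine_tmul.right, isBiaffine_tmul.left⟩

@[simp]
theorem swapHom_tmul (x : P) (y : Q) : (swapHom P Q).toFun (tmul x y) = tmul y x :=
  IsBiaffine.lift_tmul _ x y

theorem swapHom_comp_swapHom (P Q : Pol.{u}) : swapHom P Q ≫ swapHom Q P = 𝟙 (tensor P Q) :=
  tensor_hom_ext fun x y => by simp

/-- The symmetry of the tensor product, as an isomorphism. -/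
@[simps]
noncomputable def swap (P Q : Pol.{u}) : tensor P Q ≅ tensor Q P where
  hom := swapHom P Q
  inv := swapHom Q P
  hom_inv_id := swapHom_comp_swapHom P Q
  inv_hom_id := swapHom_comp_swapHom Q P

theorem isBiaffine_tmulLeft_comp_tmulLeft (P Q R : Pol.{u}) :
    IsBiaffine fun (x : P) (y : Q) => pointOf (tmulLeft (Q := R) y ≫ tmulLeft x) where
  left y := isAffine_pointOf fun z => isBiaffine_tmul.left (tmul y z)
  right x := isAffine_pointOf fun z => .of_hom (tmulRight z ≫ tmulLeft x)

theorem isBiaffine_tmulRight_comp_tmulRight (P Q R : Pol.{u}) :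
    IsBiaffine fun (y : Q) (z : R) => pointOf (tmulRight (P := P) y ≫ tmulRight z) where
  left z := isAffine_pointOf fun x => .of_hom (tmulLeft x ≫ tmulRight z)
  right y := isAffine_pointOf fun x => isBiaffine_tmul.right (tmul x y)

/-- The associator of the tensor product. -/
noncomputable def assocHom (P Q R : Pol.{u}) : tensor (tensor P Q) R ⟶ tensor P (tensor Q R) :=
  swapHom _ _ ≫ uncurry (isBiaffine_tmulLeft_comp_tmulLeft P Q R).lift

@[simp]
theorem assocHom_tmul (x : P) (y : Q) (z : R) :
    (assocHom P Q R).toFun (tmul (tmul x y) z) = tmul x (tmul y z) := by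
  simp [assocHom]

/-- The inverse of the associator of the tensor product. -/
noncomputable def assocInv (P Q R : Pol.{u}) : tensor P (tensor Q R) ⟶ tensor (tensor P Q) R :=
  uncurry (isBiaffine_tmulRight_comp_tmulRight P Q R).lift

@[simp]
theorem assocInv_tmul (x : P) (y : Q) (z : R) :
    (assocInv P Q R).toFun (tmul x (tmul y z)) = tmul (tmul x y) z := by
  simp [assocInv]

/-- The associator of the tensor product, as an isomorphism. -/
noncomputable def assoc (P Q R : Pol.{u}) : tensor (tensor P Q) R ≅ tensor P (tensor Q R) where
  hom := assocHom P Q R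
  inv := assocInv P Q R
  hom_inv_id := tensor_hom_ext_left fun x y z => by simp
  inv_hom_id := tensor_hom_ext_right fun x y z => by simp

/-- The left unitor of the tensor product. -/
noncomputable def leftUnit (P : Pol.{u}) : tensor point P ≅ P where
  hom := IsBiaffine.lift (φ := fun _ x => x) ⟨.const, fun _ => .of_hom (𝟙 P)⟩
  inv := tmulLeft star
  hom_inv_id := tensor_hom_ext fun _ _ => by
    simp only [comp_toFun, IsBiaffine.lift_tmul, tmulLeft_toFun, id_toFun]; rfl
  inv_hom_id := hom_ext fun _ => by simp

/-- The right unitor of the tensor product. -/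
noncomputable def rightUnit (P : Pol.{u}) : tensor P point ≅ P where
  hom := IsBiaffine.lift (φ := fun x _ => x) ⟨fun _ => .of_hom (𝟙 P), .const⟩
  inv := tmulRight star
  hom_inv_id := tensor_hom_ext fun _ _ => by
    simp only [comp_toFun, IsBiaffine.lift_tmul, tmulRight_toFun, id_toFun]; rfl
  inv_hom_id := hom_ext fun _ => by simp

/-- The tensor product of morphisms. -/
noncomputable def tensorMap (f : P ⟶ Q) (g : R ⟶ S) : tensor P R ⟶ tensor Q S :=
  (isBiaffine_tmul.comp f g).lift

/-- The tensor product of polytopes and its structure morphisms. -/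
@[reducible]
noncomputable def monoidalCategoryStruct : MonoidalCategoryStruct Pol.{u} where
  tensorObj := tensor
  whiskerLeft P _ _ f := tensorMap (𝟙 P) f
  whiskerRight f P := tensorMap f (𝟙 P)
  tensorHom := tensorMap
  tensorUnit := point
  associator := assoc
  leftUnitor := leftUnit
  rightUnitor := rightUnit

attribute [local instance] monoidalCategoryStruct

@[simp]
theorem tensorHom_toFun_tmul (f : P ⟶ Q) (g : R ⟶ S) (x : P) (y : R) :
    (f ⊗ₘ g).toFun (tmul x y) = tmul (f.toFun x) (g.toFun y) :=
  (isBiaffine_tmul.comp f g).lift_tmul x y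

@[simp]
theorem whiskerLeft_toFun_tmul (f : Q ⟶ R) (x : P) (y : Q) :
    (P ◁ f).toFun (tmul x y) = tmul x (f.toFun y) :=
  (isBiaffine_tmul.comp (𝟙 P) f).lift_tmul x y

@[simp]
theorem whiskerRight_toFun_tmul (f : P ⟶ Q) (x : P) (y : R) :
    (f ▷ R).toFun (tmul x y) = tmul (f.toFun x) y :=
  (isBiaffine_tmul.comp f (𝟙 R)).lift_tmul x y

@[simp]
theorem associator_hom_toFun_tmul (x : P) (y : Q) (z : R) :
    (α_ P Q R).hom.toFun (tmul (tmul x y) z) = tmul x (tmul y z) :=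
  assocHom_tmul x y z

@[simp]
theorem associator_inv_toFun_tmul (x : P) (y : Q) (z : R) :
    (α_ P Q R).inv.toFun (tmul x (tmul y z)) = tmul (tmul x y) z :=
  assocInv_tmul x y z

@[simp]
theorem leftUnitor_hom_toFun_tmul (s : point.{u}) (x : P) : (λ_ P).hom.toFun (tmul s x) = x :=
  IsBiaffine.lift_tmul ⟨.const, fun _ => .of_hom (𝟙 P)⟩ s x

@[simp]
theorem rightUnitor_hom_toFun_tmul (x : P) (s : point.{u}) : (ρ_ P).hom.toFun (tmul x s) = x :=
  IsBiaffine.lift_tmul ⟨fun _ => .of_hom (𝟙 P), .const⟩ x s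

theorem tensor_hom_ext_quadruple {T : Pol.{u}} {f g : tensor (tensor (tensor P Q) R) S ⟶ T}
    (h : ∀ x y z w, f.toFun (tmul (tmul (tmul x y) z) w) =
      g.toFun (tmul (tmul (tmul x y) z) w)) : f = g :=
  tensor_hom_ext fun v w => by
    have : tmulRight w ≫ f = tmulRight w ≫ g := tensor_hom_ext_left fun x y z => h x y z w
    exact congrArg (fun k => Hom.toFun k v) this

/-- The monoidal category of polytopes. -/
@[reducible]
noncomputable def monoidalCategory : MonoidalCategory Pol.{u} := .ofTensorHom
  (id_tensorHom_id := fun P Q => tensor_hom_ext fun x y => by simp)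
  (id_tensorHom := fun _ _ _ _ => rfl)
  (tensorHom_id := fun _ _ => rfl)
  (tensorHom_comp_tensorHom := fun _ _ _ _ => tensor_hom_ext fun x y => by simp)
  (associator_naturality := fun _ _ _ => tensor_hom_ext_left fun x y z => by simp)
  (leftUnitor_naturality := fun _ => tensor_hom_ext fun x y => by simp)
  (rightUnitor_naturality := fun _ => tensor_hom_ext fun x y => by simp)
  (pentagon := fun _ _ _ _ => tensor_hom_ext_quadruple fun x y z w => by simp)
  (triangle := fun _ _ => tensor_hom_ext_left fun x y z => by simp)

attribute [local instance] monoidalCategory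

/-- The symmetric monoidal category of polytopes. -/
@[reducible]
noncomputable def symmetricCategory : SymmetricCategory Pol.{u} where
  braiding := swap
  braiding_naturality_right _ _ _ _ := tensor_hom_ext fun x y => by simp
  braiding_naturality_left _ _ := tensor_hom_ext fun x y => by simp
  hexagon_forward _ _ _ := tensor_hom_ext_left fun x y z => by simp
  hexagon_reverse _ _ _ := tensor_hom_ext_right fun x y z => by simp
  symmetry := swapHom_comp_swapHom

/-- The functor `Hom(P, -)`. -/
def homFunctor (P : Pol.{u}) : Pol.{u} ⥤ Pol.{u} where
  obj Q := internalHom P Q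
  map g := IsAffine.hom (φ := fun φ => pointOf (ofPoint φ ≫ g))
    (isAffine_pointOf fun x => (IsAffine.of_hom g).comp (isBiaffine_ofPoint_toFun.right x))

/-- Currying as a bijection, natural in both arguments. -/
noncomputable def curryEquiv (P Q R : Pol.{u}) : (tensor P Q ⟶ R) ≃ (Q ⟶ internalHom P R) where
  toFun := curry
  invFun := uncurry
  left_inv := uncurry_curry
  right_inv := curry_uncurry

theorem uncurry_comp (f : Q ⟶ R) (g : R ⟶ internalHom P S) :
    uncurry (f ≫ g) = P ◁ f ≫ uncurry g :=
  tensor_hom_ext fun x y => by simp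

/-- The functor `Hom(P, -)` is right adjoint to `P ⊗ -`. -/
noncomputable def tensorHomAdjunction (P : Pol.{u}) : tensorLeft P ⊣ homFunctor P :=
  Adjunction.mkOfHomEquiv
    { homEquiv := curryEquiv P
      homEquiv_naturality_left_symm := uncurry_comp
      homEquiv_naturality_right := fun _ _ => rfl }

/-- The closed monoidal category of polytopes. -/
@[reducible]
noncomputable def monoidalClosed : MonoidalClosed Pol.{u} where
  closed P := { rightAdj := homFunctor P, adj := tensorHomAdjunction P }

attribute [local instance] monoidalClosed

theorem monoidalClosed_curry_toFun (f : P ⊗ Q ⟶ R) (y : Q) :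
    (MonoidalClosed.curry f).toFun y = pointOf (tmulRight y ≫ f) :=
  rfl

theorem ihom_ev_app_toFun_tmul (x : P) (φ : internalHom P Q) :
    ((ihom.ev P).app Q).toFun (tmul x φ) = (ofPoint φ).toFun x :=
  uncurry_tmul (𝟙 _) x φ

/-- The category of polytopes, enriched over itself. -/
@[reducible]
noncomputable def enrichedOrdinaryCategory : EnrichedOrdinaryCategory Pol.{u} Pol.{u} :=
  MonoidalClosed.enrichedOrdinaryCategorySelf Pol.{u}

attribute [local instance] enrichedOrdinaryCategory

theorem eId_toFun (s : point.{u}) :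
    (eId Pol.{u} P).toFun s = pointOf (𝟙 P) := by
  rw [MonoidalClosed.enrichedCategorySelf_id, MonoidalClosed.id_eq, monoidalClosed_curry_toFun]
  exact congrArg pointOf (hom_ext fun x => rightUnitor_hom_toFun_tmul x s)

theorem eComp_toFun_tmul (φ : internalHom P Q) (ψ : internalHom Q R) :
    (eComp Pol.{u} P Q R).toFun (tmul φ ψ) = pointOf (ofPoint φ ≫ ofPoint ψ) := by
  rw [MonoidalClosed.enrichedCategorySelf_comp, MonoidalClosed.comp_eq, monoidalClosed_curry_toFun]
  refine congrArg pointOf (hom_ext fun x => ?_)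
  rw [MonoidalClosed.compTranspose_eq]
  let ev {X Y : Pol.{u}} := (ihom.ev X).app Y
  calc ev.toFun ((ev ▷ internalHom Q R).toFun
          ((α_ P (internalHom P Q) (internalHom Q R)).inv.toFun (tmul x (tmul φ ψ))))
      = ev.toFun ((ev ▷ internalHom Q R).toFun (tmul (tmul x φ) ψ)) :=
        congrArg (fun v => ev.toFun ((ev ▷ internalHom Q R).toFun v))
          (associator_inv_toFun_tmul x φ ψ)
    _ = ev.toFun (tmul (ev.toFun (tmul x φ)) ψ) :=
        congrArg ev.toFun (whiskerRight_toFun_tmul ev (tmul x φ) ψ)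
    _ = (ofPoint ψ).toFun ((ofPoint φ).toFun x) := by
        rw [ihom_ev_app_toFun_tmul, ihom_ev_app_toFun_tmul]

theorem eHomEquiv_toFun (f : P ⟶ Q) (s : point.{u}) :
    (eHomEquiv Pol.{u} f).toFun s = pointOf f := by
  refine congrArg pointOf (hom_ext fun x => ?_)
  exact congrArg f.toFun (rightUnitor_hom_toFun_tmul x s)

end Monoidal

end Pol

theorem mainTheorem5 :
    -- the sets of affine maps are polytopes
    ∃ hHom : ∀ P Q : Pol.{u}, IsPolytope (Pol.homSet P Q),
    -- a symmetric closed monoidal structure on the category of polytopes, with given unit,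
    -- tensor product and internal hom
    ∃ (_ : MonoidalCategory Pol.{u}) (_ : SymmetricCategory Pol.{u}) (_ : MonoidalClosed Pol.{u})
      (hunit : Pol.point.{u} = 𝟙_ Pol.{u})
      (htensor : ∀ P Q : Pol.{u}, Pol.tensor P Q = P ⊗ Q)
      (hihom : ∀ P Q : Pol.{u}, Pol.homPolytope P Q (hHom P Q) = (ihom P).obj Q),
    -- an enrichment of the category of polytopes over itself, with the hom-polytopes as hom-objects
    ∃ (_ : EnrichedOrdinaryCategory Pol.{u} Pol.{u})
      (henr : ∀ P Q : Pol.{u}, Pol.homPolytope P Q (hHom P Q) = EnrichedCategory.Hom P Q),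
    -- the point `*` of the unit, the universal bi-affine maps `P × Q → P ⊗ Q`, and the points
    -- of the two internal homs given by an affine map
    let pt : 𝟙_ Pol.{u} := Pol.cast hunit Pol.star
    let t : ∀ {P Q : Pol.{u}}, P → Q → (P ⊗ Q : Pol.{u}) :=
      fun {P Q} x y => Pol.cast (htensor P Q) (Pol.tmul x y)
    let i : ∀ {P Q : Pol.{u}}, (P ⟶ Q) → ((ihom P).obj Q : Pol.{u}) :=
      fun {P Q} f => Pol.cast (hihom P Q) (Pol.toPoint (hHom P Q) f)
    let e : ∀ {P Q : Pol.{u}}, (P ⟶ Q) → (EnrichedCategory.Hom P Q : Pol.{u}) :=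
      fun {P Q} f => Pol.cast (henr P Q) (Pol.toPoint (hHom P Q) f)
    -- the tensor product of affine maps
    (∀ {P P' Q Q' : Pol.{u}} (f : P ⟶ P') (g : Q ⟶ Q') (x : P) (y : Q),
      (f ⊗ₘ g).toFun (t x y) = t (f.toFun x) (g.toFun y)) ∧
    -- associator, unitors and braiding
    (∀ {P Q R : Pol.{u}} (x : P) (y : Q) (z : R),
      (α_ P Q R).hom.toFun (t (t x y) z) = t x (t y z)) ∧
    (∀ {P : Pol.{u}} (x : P), (λ_ P).hom.toFun (t pt x) = x) ∧
    (∀ {P : Pol.{u}} (x : P), (ρ_ P).hom.toFun (t x pt) = x) ∧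
    (∀ {P Q : Pol.{u}} (x : P) (y : Q), (β_ P Q).hom.toFun (t x y) = t y x) ∧
    -- the internal hom functor and the evaluation `P ⊗ Hom(P, Q) → Q`
    (∀ {P Q R : Pol.{u}} (f : P ⟶ Q) (g : Q ⟶ R), ((ihom P).map g).toFun (i f) = i (f ≫ g)) ∧
    (∀ {P Q : Pol.{u}} (x : P) (f : P ⟶ Q),
      ((ihom.ev P).app Q).toFun (t x (i f)) = f.toFun x) ∧
    -- identities, composition and underlying category of the enrichment
    (∀ P : Pol.{u}, (eId Pol.{u} P).toFun pt = e (𝟙 P)) ∧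
    (∀ {P Q R : Pol.{u}} (f : P ⟶ Q) (g : Q ⟶ R),
      (eComp Pol.{u} P Q R).toFun (t (e f) (e g)) = e (f ≫ g)) ∧
    (∀ {P Q : Pol.{u}} (f : P ⟶ Q), (eHomEquiv Pol.{u} f).toFun pt = e f) := by
  refine ⟨Pol.isPolytope_homSet, Pol.monoidalCategory, Pol.symmetricCategory, Pol.monoidalClosed,
    rfl, fun _ _ => rfl, fun _ _ => rfl, Pol.enrichedOrdinaryCategory,
    fun _ _ => rfl, ?_⟩
  intro pt t i e
  exact ⟨Pol.tensorHom_toFun_tmul, Pol.associator_hom_toFun_tmul,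
    Pol.leftUnitor_hom_toFun_tmul Pol.star, fun x => Pol.rightUnitor_hom_toFun_tmul x Pol.star,
    Pol.swapHom_tmul, fun _ _ => rfl,
    fun x f => Pol.ihom_ev_app_toFun_tmul x (Pol.pointOf f),
    fun _ => Pol.eId_toFun Pol.star,
    fun f g => Pol.eComp_toFun_tmul (Pol.pointOf f) (Pol.pointOf g),
    fun f => Pol.eHomEquiv_toFun f Pol.star⟩
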